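/- Let $K$ be a field with $\operatorname{char}K\neq 2$ and let $\mathfrak g$ be a Lie algebra over $K$. Let $$\chi(\mathfrak g)=\langle \mathfrak g,\mathfrak g^{\psi}\mid [x,x^{\psi}]=0\ \text{ for all } x\in\mathfrak g\rangle ,$$ where $x\mapsto x^{\psi}$ is an isomorphism of $\mathfrak g$ onto a copy $\mathfrak g^{\psi}$. Define homomorphisms $\alpha:\chi(\mathfrak g)\to\mathfrak g$ by $\alpha(x)=\alpha(x^\psi)=x$ and $\rho:\chi(\mathfrak g)\to\mathfrak g\oplus\mathfrak g\oplus\mathfrak g$ by $\rho(x)=(x,x,0)$, $\rho(x^\psi)=(0,x,x)$, and put $L(\mathfrak g)=\ker\alpha$, $W(\mathfrak g)=\ker\rho$ and $$R(\mathfrak g)=[\mathfrak g,[L(\mathfrak g),\mathfrak g^{\psi}]]\subseteq\chi(\mathfrak g),$$ where $[A,B]$ denotes the linear span of all $[a,b]$ with $a\in A$, $b\in B$. **Theorem.** Suppose that $\mathfrak g$ is a free Lie algebra with free basis $(x_i)_{i\in X}$, where $X$ is a (finite or infinite) set with at least $3$ elements. Then: 1. $R(\mathfrak g)$ is an abelian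 ideal of $\chi(\mathfrak g)$ contained in $W(\mathfrak g)$, and it is infinite-dimensional over $K$. 2. Write $a_i=x_i-x_i^{\psi}$ and $b_{i,j}=[x_i,x_j]-[x_i,x_j]^{\psi}$. For all pairwise distinct $i,j,k\in X$ and every even integer $n\geq 2$, the element $$[b_{i,j},\underbrace{a_j,\dots,a_j}_{n},a_k]-[[a_i,a_j],\underbrace{a_j,\dots,a_j}_{n-1},b_{j,k}]$$ (right-normed brackets $[y_1,\dots,y_r]=[y_1,[y_2,\dots,[y_{r-1},y_r]\dots]]$; $a_j$ occurs $n$ times in each of the two terms) lies in $R(\mathfrak g)$ and in $L(\mathfrak g)$ and is non-zero. 3. $W(\mathfrak g)$ is infinite-dimensional. In particular, if $X$ is finite, then $\mathfrak g$ is a finitely presentable Lie algebra with $W(\mathfrak g)$ of infinite dimension. -/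

import Mathlib

noncomputable section

namespace WeakComm

universe u v w

section Presentation

variable (K : Type u) (g : Type v) [Field K] [LieRing g] [LieAlgebra K g]

/-- The letter of the left copy `g` attached to `x`. -/
def letterL (x : g) : FreeLieAlgebra K (g ⊕ g) := FreeLieAlgebra.of K (Sum.inl x)

/-- The letter of the right copy `g^ψ` attached to `x`. -/
def letterR (x : g) : FreeLieAlgebra K (g ⊕ g) := FreeLieAlgebra.of K (Sum.inr x)

/-- The relators of `⟨g, g^ψ | [x, x^ψ] = 0 for all x ∈ g⟩`: the first six families say that the two
families of letters form homomorphic copies of the Lie algebra `g`, the last one is weak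
commutativity. -/
inductive Relator : FreeLieAlgebra K (g ⊕ g) → Prop
  | addL (x y : g) : Relator (letterL K g (x + y) - (letterL K g x + letterL K g y))
  | smulL (c : K) (x : g) : Relator (letterL K g (c • x) - c • letterL K g x)
  | lieL (x y : g) : Relator (letterL K g ⁅x, y⁆ - ⁅letterL K g x, letterL K g y⁆)
  | addR (x y : g) : Relator (letterR K g (x + y) - (letterR K g x + letterR K g y))
  | smulR (c : K) (x : g) : Relator (letterR K g (c • x) - c • letterR K g x)
  | lieR (x y : g) : Relator (letterR K g ⁅x, y⁆ - ⁅letterR K g x, letterR K g y⁆)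
  | comm (x : g) : Relator ⁅letterL K g x, letterR K g x⁆

/-- The ideal of the free Lie algebra generated by the relators. -/
def relIdeal : LieIdeal K (FreeLieAlgebra K (g ⊕ g)) :=
  LieSubmodule.lieSpan K (FreeLieAlgebra K (g ⊕ g)) {r | Relator K g r}

/-- The weak commutativity construction `χ(g) = ⟨g, g^ψ | [x, x^ψ] = 0 for all x ∈ g⟩`. -/
def Chi : Type (max u v) := FreeLieAlgebra K (g ⊕ g) ⧸ relIdeal K g

instance instLieRingChi : LieRing (Chi K g) :=
  inferInstanceAs (LieRing (FreeLieAlgebra K (g ⊕ g) ⧸ relIdeal K g))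

instance instLieAlgebraChi : LieAlgebra K (Chi K g) :=
  inferInstanceAs (LieAlgebra K (FreeLieAlgebra K (g ⊕ g) ⧸ relIdeal K g))

/-- The quotient map onto `χ(g)`. -/
def chiMk : FreeLieAlgebra K (g ⊕ g) →ₗ⁅K⁆ Chi K g where
  toFun := fun a => LieSubmodule.Quotient.mk (N := relIdeal K g) a
  map_add' := fun _ _ => rfl
  map_smul' := fun _ _ => rfl
  map_lie' := rfl

theorem chiMk_surjective : Function.Surjective (chiMk K g) := Quot.mk_surjective

theorem chiMk_eq_zero_iff (a : FreeLieAlgebra K (g ⊕ g)) :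
    chiMk K g a = 0 ↔ a ∈ relIdeal K g :=
  Submodule.Quotient.mk_eq_zero (relIdeal K g).toSubmodule

theorem chiMk_relator {a : FreeLieAlgebra K (g ⊕ g)} (h : Relator K g a) : chiMk K g a = 0 :=
  (chiMk_eq_zero_iff K g a).2 (LieSubmodule.subset_lieSpan h)

/-- The canonical homomorphism `g → χ(g)`, `x ↦ x`. -/
def inc : g →ₗ⁅K⁆ Chi K g where
  toFun x := chiMk K g (letterL K g x)
  map_add' x y := by
    have h := chiMk_relator K g (Relator.addL x y)
    rw [map_sub, map_add] at h
    exact sub_eq_zero.1 h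
  map_smul' c x := by
    have h := chiMk_relator K g (Relator.smulL c x)
    rw [map_sub, map_smul] at h
    exact sub_eq_zero.1 h
  map_lie' {x y} := by
    have h := chiMk_relator K g (Relator.lieL x y)
    rw [map_sub, LieHom.map_lie] at h
    exact sub_eq_zero.1 h

/-- The canonical homomorphism `g → χ(g)`, `x ↦ x^ψ`. -/
def psi : g →ₗ⁅K⁆ Chi K g where
  toFun x := chiMk K g (letterR K g x)
  map_add' x y := by
    have h := chiMk_relator K g (Relator.addR x y)
    rw [map_sub, map_add] at h
    exact sub_eq_zero.1 h
  map_smul' c x := by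
    have h := chiMk_relator K g (Relator.smulR c x)
    rw [map_sub, map_smul] at h
    exact sub_eq_zero.1 h
  map_lie' {x y} := by
    have h := chiMk_relator K g (Relator.lieR x y)
    rw [map_sub, LieHom.map_lie] at h
    exact sub_eq_zero.1 h

theorem inc_lie_psi (x : g) : ⁅inc K g x, psi K g x⁆ = 0 := by
  have h := chiMk_relator K g (Relator.comm x)
  rwa [LieHom.map_lie] at h

end Presentation

section Lift

variable {K : Type u} {g : Type v} {M : Type w} [Field K] [LieRing g] [LieAlgebra K g]
  [LieRing M] [LieAlgebra K M]

/-- The homomorphism from the free Lie algebra underlying `chiLift`. -/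
def freeLift (f h : g →ₗ⁅K⁆ M) : FreeLieAlgebra K (g ⊕ g) →ₗ⁅K⁆ M :=
  FreeLieAlgebra.lift K (Sum.elim f h)

theorem freeLift_letterL (f h : g →ₗ⁅K⁆ M) (x : g) : freeLift f h (letterL K g x) = f x := by
  simp [freeLift, letterL]

theorem freeLift_letterR (f h : g →ₗ⁅K⁆ M) (x : g) : freeLift f h (letterR K g x) = h x := by
  simp [freeLift, letterR]

theorem relIdeal_le_ker (f h : g →ₗ⁅K⁆ M) (hfh : ∀ x, ⁅f x, h x⁆ = 0) :
    relIdeal K g ≤ (freeLift f h).ker := by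
  refine LieSubmodule.lieSpan_le.2 ?_
  intro r hr
  change r ∈ (freeLift f h).ker
  rw [LieHom.mem_ker]
  have hr' : Relator K g r := hr
  cases hr' <;>
    simp [LieHom.map_lie, freeLift_letterL, freeLift_letterR, hfh]

/-- The universal property of `χ(g)`: homomorphisms `f`, `h` with `[f x, h x] = 0` for all `x`
induce a homomorphism sending `x` to `f x` and `x^ψ` to `h x`. -/
def chiLift (f h : g →ₗ⁅K⁆ M) (hfh : ∀ x, ⁅f x, h x⁆ = 0) : Chi K g →ₗ⁅K⁆ M :=
  { (relIdeal K g).toSubmodule.liftQ (freeLift f h : FreeLieAlgebra K (g ⊕ g) →ₗ[K] M)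
      (fun a ha => by
        have := relIdeal_le_ker f h hfh ha
        rwa [LieHom.mem_ker] at this) with
    map_lie' := by
      intro x y
      obtain ⟨x, rfl⟩ := chiMk_surjective K g x
      obtain ⟨y, rfl⟩ := chiMk_surjective K g y
      exact (freeLift f h).map_lie x y }

theorem chiLift_chiMk (f h : g →ₗ⁅K⁆ M) (hfh : ∀ x, ⁅f x, h x⁆ = 0)
    (a : FreeLieAlgebra K (g ⊕ g)) : chiLift f h hfh (chiMk K g a) = freeLift f h a := rfl

theorem chiLift_inc (f h : g →ₗ⁅K⁆ M) (hfh : ∀ x, ⁅f x, h x⁆ = 0) (x : g) :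
    chiLift f h hfh (inc K g x) = f x := freeLift_letterL f h x

theorem chiLift_psi (f h : g →ₗ⁅K⁆ M) (hfh : ∀ x, ⁅f x, h x⁆ = 0) (x : g) :
    chiLift f h hfh (psi K g x) = h x := freeLift_letterR f h x

end Lift

section Ideals

variable (K : Type u) (g : Type v) [Field K] [LieRing g] [LieAlgebra K g]

/-- `α : χ(g) → g` with `α(x) = α(x^ψ) = x`. -/
def alpha : Chi K g →ₗ⁅K⁆ g :=
  chiLift LieHom.id LieHom.id (fun x => by simp)

/-- `ρ : χ(g) → g ⊕ g ⊕ g` with `ρ(x) = (x, x, 0)` and `ρ(x^ψ) = (0, x, x)`. -/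
def rho : Chi K g →ₗ⁅K⁆ g × g × g :=
  chiLift (LieHom.prod LieHom.id (LieHom.prod LieHom.id 0))
    (LieHom.prod 0 (LieHom.prod LieHom.id LieHom.id)) (fun x => by simp)

theorem alpha_inc (x : g) : alpha K g (inc K g x) = x := chiLift_inc _ _ _ x

theorem alpha_psi (x : g) : alpha K g (psi K g x) = x := chiLift_psi _ _ _ x

theorem rho_inc (x : g) : rho K g (inc K g x) = (x, x, 0) := chiLift_inc _ _ _ x

theorem rho_psi (x : g) : rho K g (psi K g x) = (0, x, x) := chiLift_psi _ _ _ x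

/-- The ideal `L(g) = ker α`. -/
def L : LieIdeal K (Chi K g) := (alpha K g).ker

/-- The ideal `W(g) = ker ρ`. -/
def W : LieIdeal K (Chi K g) := (rho K g).ker

variable {K} in
/-- `[A, B]`: the linear span of all brackets `[a, b]` with `a ∈ A` and `b ∈ B`, for linear
subspaces `A`, `B` of a Lie algebra. -/
def bracketSpan {M : Type w} [LieRing M] [LieAlgebra K M] (A B : Submodule K M) :
    Submodule K M :=
  Submodule.span K {z | ∃ a ∈ A, ∃ b ∈ B, z = ⁅a, b⁆}

/-- The copy of `g` in `χ(g)`. -/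
def copyL : Submodule K (Chi K g) := (inc K g).range.toSubmodule

/-- The copy `g^ψ` in `χ(g)`. -/
def copyR : Submodule K (Chi K g) := (psi K g).range.toSubmodule

/-- `R(g) = [g, [L(g), g^ψ]]`. -/
def R : Submodule K (Chi K g) :=
  bracketSpan (copyL K g) (bracketSpan (L K g).toSubmodule (copyR K g))

end Ideals

section Free

variable (K : Type u) {g : Type v} {X : Type w} [Field K] [LieRing g] [LieAlgebra K g]

/-- The family `x` is a free basis of the Lie algebra `g`: the induced homomorphism from the free
Lie algebra on the index set to `g` is bijective. -/
def IsFreeBasis (x : X → g) : Prop := Function.Bijective (FreeLieAlgebra.lift K x)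

/-- `g` is finitely presentable: it is isomorphic to the quotient of a free Lie algebra on finitely
many letters by the ideal generated by finitely many elements. -/
def IsFinitelyPresentable (g : Type v) [LieRing g] [LieAlgebra K g] : Prop :=
  ∃ (n : ℕ) (S : Set (FreeLieAlgebra K (Fin n))), S.Finite ∧
    Nonempty ((FreeLieAlgebra K (Fin n) ⧸
      (LieSubmodule.lieSpan K (FreeLieAlgebra K (Fin n)) S :
        LieIdeal K (FreeLieAlgebra K (Fin n)))) ≃ₗ⁅K⁆ g)

/-- `a_i = x_i - x_i^ψ`. -/
def a (x : X → g) (i : X) : Chi K g := inc K g (x i) - psi K g (x i)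

/-- `b_{i,j} = [x_i, x_j] - [x_i, x_j]^ψ`. -/
def b (x : X → g) (i j : X) : Chi K g := inc K g ⁅x i, x j⁆ - psi K g ⁅x i, x j⁆

/-- The element `[b_{ij}, a_j, …, a_j, a_k] - [[a_i, a_j], a_j, …, a_j, b_{jk}]` (right-normed
brackets), in which `a_j` occurs exactly `n` times in each of the two terms, for `n ≥ 1`; in the
second term one of these occurrences is inside `[a_i, a_j]`. -/
def f (x : X → g) (i j k : X) (n : ℕ) : Chi K g :=
  ⁅b K x i j, (fun z => ⁅a K x j, z⁆)^[n] (a K x k)⁆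
    - ⁅⁅a K x i, a K x j⁆, (fun z => ⁅a K x j, z⁆)^[n - 1] (b K x j k)⁆

end Free

end WeakComm

end

/-! Put d(x) = x - x^ψ. Polarizing [x, x^ψ] = 0 gives 2[x, d y] = [d x, d y] + d[x, y], and
computing the action of [x, y] on d z in two ways yields [[d x, d y], d z] = d[[x, y], z]
(`lie_lie_diff`). Since 2 is invertible, both copies of g preserve d(g) + [d(g), d(g)], so this is
an ideal; it contains L(g) (`L_le`). An element of [d(g), d(g)] acts on d(g) through some u in g
that its image under ρ reveals, so W(g) centralizes L(g).

The same identities identify R(g) with the span of the boundaries `jac x y z` (`R_eq_jacSpan`). It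
is an ideal inside W(g) ⊆ L(g), hence abelian. The explicit elements are, up to sign, such
boundaries (`f_eq_neg_jac`).

To see that they are non-zero, represent χ(g) by 4 × 4 matrices over a polynomial ring in t, one
copy of g in the top row and the other in the last column. A mixed bracket is a 2 × 2 determinant in
the corner, which vanishes when the parameters agree, so weak commutativity holds. For even n the
element goes to 4t^(n+1) in the corner (`exists_detect`); distinct powers of t make infinitely many
of them independent. -/

noncomputable section

namespace WeakComm

universe u v w

/-! ### Generation of χ(g) by the two copies, and the map d. -/

section Structure

variable (K : Type u) (g : Type v) [Field K] [LieRing g] [LieAlgebra K g]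

/-- A Lie subalgebra of `χ(g)` containing both copies of `g` is everything. -/
theorem mem_of_inc_psi_mem (S : LieSubalgebra K (Chi K g)) (hi : ∀ x, inc K g x ∈ S)
    (hp : ∀ x, psi K g x ∈ S) (c : Chi K g) : c ∈ S := by
  let F : FreeLieAlgebra K (g ⊕ g) →ₗ⁅K⁆ S :=
    FreeLieAlgebra.lift K (Sum.elim (fun x => ⟨inc K g x, hi x⟩) (fun x => ⟨psi K g x, hp x⟩))
  have h : S.incl.comp F = chiMk K g := by
    ext y
    rcases y with y | y <;> simp [F] <;> rfl
  obtain ⟨a, rfl⟩ := chiMk_surjective K g c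
  rw [← h]
  exact (F a).2

/-- A subspace of `χ(g)` that is stable under both copies of `g` is an ideal. -/
theorem lie_mem_of_inc_psi (N : Submodule K (Chi K g))
    (hi : ∀ x, ∀ n ∈ N, ⁅inc K g x, n⁆ ∈ N) (hp : ∀ x, ∀ n ∈ N, ⁅psi K g x, n⁆ ∈ N)
    (c : Chi K g) {n : Chi K g} (hn : n ∈ N) : ⁅c, n⁆ ∈ N := by
  let S : LieSubalgebra K (Chi K g) :=
    { carrier := {c | ∀ n ∈ N, ⁅c, n⁆ ∈ N}
      add_mem' := fun {a b} ha hb n hn => by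
        rw [add_lie]; exact N.add_mem (ha n hn) (hb n hn)
      zero_mem' := fun n _ => by rw [zero_lie]; exact N.zero_mem
      smul_mem' := fun t a ha n hn => by
        rw [smul_lie]; exact N.smul_mem t (ha n hn)
      lie_mem' := fun {a b} ha hb n hn => by
        rw [lie_lie]; exact N.sub_mem (ha _ (hb n hn)) (hb _ (ha n hn)) }
  exact mem_of_inc_psi_mem K g S hi hp c n hn

/-- The linear map `x ↦ x - x^ψ`. -/
def diff : g →ₗ[K] Chi K g := (inc K g : g →ₗ[K] Chi K g) - (psi K g : g →ₗ[K] Chi K g)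

theorem diff_apply (x : g) : diff K g x = inc K g x - psi K g x := rfl

theorem psi_eq (x : g) : psi K g x = inc K g x - diff K g x := by
  rw [diff_apply]; abel

theorem inc_lie_diff_self (x : g) : ⁅inc K g x, diff K g x⁆ = 0 := by
  rw [diff_apply, lie_sub, lie_self, inc_lie_psi, sub_zero]

/-- Polarization of [x, d x] = 0. -/
theorem inc_lie_diff_swap (x y : g) :
    ⁅inc K g x, diff K g y⁆ + ⁅inc K g y, diff K g x⁆ = 0 := by
  have h := inc_lie_diff_self K g (y + x)
  simpa [inc_lie_diff_self] using h

/-- Expanding d[x, y] with y^ψ = y - d y gives [x, d y] - [y, d x] - [d x, d y], and the two mixed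
terms are equal by polarization. -/
theorem two_smul_inc_lie_diff (x y : g) :
    (2 : K) • ⁅inc K g x, diff K g y⁆ = ⁅diff K g x, diff K g y⁆ + diff K g ⁅x, y⁆ := by
  have h := inc_lie_diff_swap K g x y
  have e : diff K g ⁅x, y⁆ = ⁅inc K g x, diff K g y⁆ - ⁅inc K g y, diff K g x⁆
      - ⁅diff K g x, diff K g y⁆ := by
    rw [diff_apply K g ⁅x, y⁆, LieHom.map_lie, LieHom.map_lie, psi_eq, psi_eq,
      ← lie_skew (inc K g y) (diff K g x)]
    simp only [sub_lie, lie_sub]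
    abel
  rw [e]
  linear_combination (norm := module) h

theorem two_smul_inc_lie_lie_diff_aux (x y z : g) :
    (2 : K) • ⁅inc K g x, ⁅diff K g y, diff K g z⁆⁆ =
      ⁅⁅diff K g x, diff K g y⁆, diff K g z⁆ + ⁅diff K g ⁅x, y⁆, diff K g z⁆
      + ⁅diff K g y, ⁅diff K g x, diff K g z⁆⁆ + ⁅diff K g y, diff K g ⁅x, z⁆⁆ := by
  rw [leibniz_lie, smul_add, ← smul_lie, two_smul_inc_lie_diff, ← lie_smul,
    two_smul_inc_lie_diff, add_lie, lie_add]
  abel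

variable {K} in
theorem eq_of_two_smul_eq (hK : (2 : K) ≠ 0) {M : Type w} [AddCommGroup M] [Module K M] {x y : M}
    (h : (2 : K) • x = (2 : K) • y) : x = y := smul_right_injective M hK h

/-! ### Triple system identities. -/

variable {K}

/-- `L(g)` behaves like an enveloping algebra of the Lie triple system underlying `g`. -/
theorem lie_lie_diff (x y z : g) :
    ⁅⁅diff K g x, diff K g y⁆, diff K g z⁆ = diff K g ⁅⁅x, y⁆, z⁆ := by
  -- Four times [[x, y], d z] is computed directly (`h1`) and as a commutator of two successive
  -- actions (`h3`, `h4`); the difference is the claim.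
  have h1 := two_smul_inc_lie_diff K g ⁅x, y⁆ z
  rw [LieHom.map_lie, lie_lie] at h1
  have h2 (x y z : g) : (2 : K) • (2 : K) • ⁅inc K g x, ⁅inc K g y, diff K g z⁆⁆ =
      ⁅⁅diff K g x, diff K g y⁆, diff K g z⁆ + ⁅diff K g ⁅x, y⁆, diff K g z⁆
      + ⁅diff K g y, ⁅diff K g x, diff K g z⁆⁆ + ⁅diff K g y, diff K g ⁅x, z⁆⁆
      + ⁅diff K g x, diff K g ⁅y, z⁆⁆ + diff K g ⁅x, ⁅y, z⁆⁆ := by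
    rw [← lie_smul, two_smul_inc_lie_diff, lie_add, smul_add, two_smul_inc_lie_lie_diff_aux,
      two_smul_inc_lie_diff]
    abel
  have h3 := h2 x y z
  have h4 := h2 y x z
  have h5 : diff K g ⁅⁅x, y⁆, z⁆ = diff K g ⁅x, ⁅y, z⁆⁆ - diff K g ⁅y, ⁅x, z⁆⁆ := by
    rw [lie_lie, map_sub]
  have h6 : diff K g ⁅y, x⁆ = - diff K g ⁅x, y⁆ := by rw [← lie_skew, map_neg]
  rw [h6, ← lie_skew (diff K g y) (diff K g x), neg_lie, neg_lie] at h4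
  have h7 := lie_lie (diff K g x) (diff K g y) (diff K g z)
  linear_combination (norm := module) (2 : K) • h1 - h3 + h4 + h5 - h7

theorem diff_lie_lie_diff (x y z : g) :
    ⁅diff K g x, ⁅diff K g y, diff K g z⁆⁆ = diff K g ⁅x, ⁅y, z⁆⁆ := by
  rw [← lie_skew, lie_lie_diff (K := K) g, ← map_neg, lie_skew]

theorem two_smul_inc_lie_lie_diff (x y z : g) :
    (2 : K) • ⁅inc K g x, ⁅diff K g y, diff K g z⁆⁆ =
      ⁅diff K g ⁅x, y⁆, diff K g z⁆ + ⁅diff K g y, diff K g ⁅x, z⁆⁆ + diff K g ⁅x, ⁅y, z⁆⁆ := by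
  rw [two_smul_inc_lie_lie_diff_aux, lie_lie_diff g, diff_lie_lie_diff g,
    leibniz_lie x y z, map_add]
  abel

theorem two_smul_psi_lie_diff (x y : g) :
    (2 : K) • ⁅psi K g x, diff K g y⁆ = diff K g ⁅x, y⁆ - ⁅diff K g x, diff K g y⁆ := by
  have h := two_smul_inc_lie_diff K g x y
  rw [psi_eq, sub_lie]
  linear_combination (norm := module) h

theorem two_smul_psi_lie_lie_diff (x y z : g) :
    (2 : K) • ⁅psi K g x, ⁅diff K g y, diff K g z⁆⁆ =
      ⁅diff K g ⁅x, y⁆, diff K g z⁆ + ⁅diff K g y, diff K g ⁅x, z⁆⁆ - diff K g ⁅x, ⁅y, z⁆⁆ := by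
  have h := two_smul_inc_lie_lie_diff (K := K) g x y z
  rw [psi_eq, sub_lie, diff_lie_lie_diff g]
  linear_combination (norm := module) h

/-! ### Decomposition of L(g) into odd and even parts. -/

variable (K)

/-- The even part of `L(g)`. -/
def evenPart : Submodule K (Chi K g) :=
  Submodule.span K {c | ∃ y z, c = ⁅diff K g y, diff K g z⁆}

variable {K}

theorem lie_diff_mem_evenPart (y z : g) : ⁅diff K g y, diff K g z⁆ ∈ evenPart K g :=
  Submodule.subset_span ⟨y, z, rfl⟩

theorem mem_of_two_smul_mem (hK : (2 : K) ≠ 0) {M : Type w} [AddCommGroup M] [Module K M]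
    {N : Submodule K M} {m : M} (h : (2 : K) • m ∈ N) : m ∈ N :=
  (N.smul_mem_iff hK).1 h

theorem L_le (hK : (2 : K) ≠ 0) :
    (L K g).toSubmodule ≤ (diff K g).range ⊔ evenPart K g := by
  set T := (diff K g).range ⊔ evenPart K g with hT
  have hd (x : g) : diff K g x ∈ T := Submodule.mem_sup_left ⟨x, rfl⟩
  have he (x y : g) : ⁅diff K g x, diff K g y⁆ ∈ T :=
    Submodule.mem_sup_right (lie_diff_mem_evenPart g x y)
  have key (c : Chi K g) (h1 : ∀ y, ⁅c, diff K g y⁆ ∈ T)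
      (h2 : ∀ y z, ⁅c, ⁅diff K g y, diff K g z⁆⁆ ∈ T) (n : Chi K g) (hn : n ∈ T) : ⁅c, n⁆ ∈ T := by
    have : T ≤ T.comap (LieAlgebra.ad K (Chi K g) c) := by
      refine sup_le ?_ (Submodule.span_le.2 ?_)
      · rintro _ ⟨y, rfl⟩
        exact h1 y
      · rintro _ ⟨y, z, rfl⟩
        exact h2 y z
    exact this hn
  have hI (c n : Chi K g) (hn : n ∈ T) : ⁅c, n⁆ ∈ T := by
    refine lie_mem_of_inc_psi K g T (fun x => key _ ?_ ?_) (fun x => key _ ?_ ?_) c hn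
    · intro y
      refine mem_of_two_smul_mem hK ?_
      rw [two_smul_inc_lie_diff]
      exact T.add_mem (he _ _) (hd _)
    · intro y z
      refine mem_of_two_smul_mem hK ?_
      rw [two_smul_inc_lie_lie_diff g]
      exact T.add_mem (T.add_mem (he _ _) (he _ _)) (hd _)
    · intro y
      refine mem_of_two_smul_mem hK ?_
      rw [two_smul_psi_lie_diff]
      exact T.sub_mem (hd _) (he _ _)
    · intro y z
      refine mem_of_two_smul_mem hK ?_
      rw [two_smul_psi_lie_lie_diff g]
      exact T.sub_mem (T.add_mem (he _ _) (he _ _)) (hd _)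
  -- Since T is an ideal, the c congruent to `inc (alpha c)` modulo T form a subalgebra. It contains
  -- both copies of g, so it is everything; on the kernel of α this says c ∈ T.
  let S : LieSubalgebra K (Chi K g) :=
    { T.comap (LinearMap.id - (inc K g : g →ₗ[K] Chi K g) ∘ₗ (alpha K g : Chi K g →ₗ[K] g)) with
      lie_mem' := fun {a b} ha hb => by
        change a - inc K g (alpha K g a) ∈ T at ha
        change b - inc K g (alpha K g b) ∈ T at hb
        change ⁅a, b⁆ - inc K g (alpha K g ⁅a, b⁆) ∈ T
        have : ⁅a, b⁆ - inc K g (alpha K g ⁅a, b⁆) =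
            ⁅a, b - inc K g (alpha K g b)⁆
              - ⁅inc K g (alpha K g b), a - inc K g (alpha K g a)⁆ := by
          rw [LieHom.map_lie, LieHom.map_lie, lie_sub, lie_sub,
            ← lie_skew (inc K g (alpha K g b)) a,
            ← lie_skew (inc K g (alpha K g b)) (inc K g (alpha K g a))]
          abel
        rw [this]
        exact T.sub_mem (hI _ _ hb) (hI _ _ ha) }
  intro c hc
  have hcS : c ∈ S := by
    refine mem_of_inc_psi_mem K g S ?_ ?_ c
    · intro x
      change inc K g x - inc K g (alpha K g (inc K g x)) ∈ T
      rw [alpha_inc, sub_self]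
      exact T.zero_mem
    · intro x
      change psi K g x - inc K g (alpha K g (psi K g x)) ∈ T
      rw [alpha_psi, ← neg_sub, ← diff_apply]
      exact T.neg_mem (hd x)
  change c - inc K g (alpha K g c) ∈ T at hcS
  have : alpha K g c = 0 := hc
  rwa [this, map_zero, sub_zero] at hcS

theorem diff_mem_L (x : g) : diff K g x ∈ L K g := by
  change alpha K g (diff K g x) = 0
  rw [diff_apply, map_sub, alpha_inc, alpha_psi, sub_self]

/-! ### W(g) centralizes L(g). -/

theorem alpha_eq_rho (c : Chi K g) : alpha K g c = (rho K g c).2.1 := by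
  let S : LieSubalgebra K (Chi K g) :=
    { LinearMap.eqLocus (alpha K g : Chi K g →ₗ[K] g) ((LinearMap.fst K g g ∘ₗ
        LinearMap.snd K g (g × g)) ∘ₗ (rho K g : Chi K g →ₗ[K] g × g × g)) with
      lie_mem' := fun {a b} ha hb => by
        change alpha K g a = (rho K g a).2.1 at ha
        change alpha K g b = (rho K g b).2.1 at hb
        change alpha K g ⁅a, b⁆ = (rho K g ⁅a, b⁆).2.1
        rw [LieHom.map_lie, LieHom.map_lie, ha, hb]
        rfl }
  refine mem_of_inc_psi_mem K g S (fun x => ?_) (fun x => ?_) c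
  · change alpha K g _ = (rho K g _).2.1
    rw [alpha_inc, rho_inc]
  · change alpha K g _ = (rho K g _).2.1
    rw [alpha_psi, rho_psi]

theorem W_le_L : W K g ≤ L K g := by
  intro c hc
  have hc' : rho K g c = 0 := hc
  change alpha K g c = 0
  rw [alpha_eq_rho, hc']
  rfl

theorem rho_diff (x : g) : rho K g (diff K g x) = (x, 0, -x) := by
  rw [diff_apply, map_sub, rho_inc, rho_psi]
  simp

/-- For [d y, d z] take u = [y, z]; the rest is linearity. Thus ρ determines the action of an even
element on d(g). -/
theorem exists_of_mem_evenPart {c : Chi K g} (hc : c ∈ evenPart K g) :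
    ∃ u : g, rho K g c = (u, 0, u) ∧ ∀ z, ⁅c, diff K g z⁆ = diff K g ⁅u, z⁆ := by
  induction hc using Submodule.span_induction with
  | mem c hc =>
    obtain ⟨y, z, rfl⟩ := hc
    refine ⟨⁅y, z⁆, ?_, lie_lie_diff g y z⟩
    rw [LieHom.map_lie, rho_diff, rho_diff]
    simp
  | zero => exact ⟨0, by rw [map_zero]; rfl, by simp⟩
  | add a b _ _ ha hb =>
    obtain ⟨u, hu, hu'⟩ := ha
    obtain ⟨v, hv, hv'⟩ := hb
    exact ⟨u + v, by simp [hu, hv], fun z => by rw [add_lie, hu', hv', add_lie, map_add]⟩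
  | smul t a _ ha =>
    obtain ⟨u, hu, hu'⟩ := ha
    exact ⟨t • u, by simp [hu], fun z => by rw [smul_lie, hu', smul_lie, map_smul]⟩

/-- `W(g)` centralizes `L(g)`. -/
theorem lie_eq_zero_of_mem_W_of_mem_L (hK : (2 : K) ≠ 0) {c d : Chi K g} (hc : c ∈ W K g)
    (hd : d ∈ L K g) : ⁅c, d⁆ = 0 := by
  have hz (z : g) : ⁅c, diff K g z⁆ = 0 := by
    obtain ⟨_, ⟨x, rfl⟩, e, he, rfl⟩ := Submodule.mem_sup.1 (L_le g hK (W_le_L g hc))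
    obtain ⟨u, hu, hu'⟩ := exists_of_mem_evenPart g he
    have h0 : rho K g (diff K g x + e) = 0 := hc
    rw [map_add, rho_diff, hu] at h0
    simp only [Prod.mk_add_mk, Prod.mk_eq_zero] at h0
    -- The outer coordinates of ρ(d x + e) are u + x and u - x.
    have hx : x = 0 := by
      refine eq_of_two_smul_eq hK ?_
      linear_combination (norm := module) h0.1 - h0.2.2
    have hu0 : u = 0 := by simpa [hx] using h0.1
    rw [add_lie, hu', hx, hu0]
    simp
  have : (diff K g).range ⊔ evenPart K g ≤ (LieAlgebra.ad K (Chi K g) c).ker := by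
    refine sup_le ?_ (Submodule.span_le.2 ?_)
    · rintro _ ⟨y, rfl⟩
      exact hz y
    · rintro _ ⟨y, z, rfl⟩
      change ⁅c, ⁅diff K g y, diff K g z⁆⁆ = 0
      rw [leibniz_lie, hz, hz, zero_lie, lie_zero, add_zero]
  exact this (L_le g hK hd)

/-! ### R(g) as the span of boundaries. -/

variable {g}

/-- The image in `L(g)` of the boundary of `x ∧ y ∧ z`. -/
def jac (x y z : g) : Chi K g :=
  ⁅diff K g ⁅x, y⁆, diff K g z⁆ + ⁅diff K g ⁅y, z⁆, diff K g x⁆ + ⁅diff K g ⁅z, x⁆, diff K g y⁆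

theorem map_lie_jacobi {M : Type w} [AddCommGroup M] [Module K M] (φ : g →ₗ[K] M) (u x y z : g) :
    φ ⁅u, ⁅⁅x, y⁆, z⁆⁆ + φ ⁅u, ⁅⁅y, z⁆, x⁆⁆ + φ ⁅u, ⁅⁅z, x⁆, y⁆⁆ = 0 := by
  rw [← map_add, ← map_add, ← lie_add, ← lie_add]
  have : ⁅⁅x, y⁆, z⁆ + ⁅⁅y, z⁆, x⁆ + ⁅⁅z, x⁆, y⁆ = 0 := by
    rw [← lie_skew ⁅x, y⁆ z, ← lie_skew ⁅y, z⁆ x, ← lie_skew ⁅z, x⁆ y]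
    linear_combination (norm := abel) -(lie_jacobi x y z)
  rw [this, lie_zero, map_zero]

/-- The boundary is equivariant up to the factor 2: u acts as a derivation on the three arguments,
and the leftover d-terms cancel by Jacobi. -/
theorem two_smul_inc_lie_jac (u x y z : g) :
    (2 : K) • ⁅inc K g u, (jac x y z : Chi K g)⁆ =
      jac ⁅u, x⁆ y z + jac x ⁅u, y⁆ z + jac x y ⁅u, z⁆ := by
  have h := map_lie_jacobi (diff K g) u x y z
  simp only [jac, lie_add, smul_add, two_smul_inc_lie_lie_diff g]
  rw [leibniz_lie u x y, leibniz_lie u y z, leibniz_lie u z x]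
  simp only [map_add, add_lie] at h ⊢
  linear_combination (norm := abel) h

theorem two_smul_psi_lie_jac (u x y z : g) :
    (2 : K) • ⁅psi K g u, (jac x y z : Chi K g)⁆ =
      jac ⁅u, x⁆ y z + jac x ⁅u, y⁆ z + jac x y ⁅u, z⁆ := by
  have h := map_lie_jacobi (diff K g) u x y z
  simp only [jac, lie_add, smul_add, two_smul_psi_lie_lie_diff g]
  rw [leibniz_lie u x y, leibniz_lie u y z, leibniz_lie u z x]
  simp only [map_add, add_lie] at h ⊢
  linear_combination (norm := abel) -h

/-- The two copies act with opposite signs on the parity-changing terms, so the contributions d[y,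
[z, x]] cancel and only a boundary remains. -/
theorem four_smul_inc_lie_psi_lie_diff (x y z : g) :
    (2 : K) • (2 : K) • ⁅inc K g y, ⁅psi K g z, diff K g x⁆⁆ = -jac x y z := by
  rw [← lie_smul, two_smul_psi_lie_diff, lie_sub, smul_sub, two_smul_inc_lie_lie_diff g,
    two_smul_inc_lie_diff, jac, ← lie_skew (diff K g y) (diff K g ⁅z, x⁆),
    ← lie_skew (diff K g z) (diff K g ⁅y, x⁆), ← lie_skew y x, map_neg, neg_lie]
  abel

/-- The bookkeeping for the even part of L(g), isolated for an arbitrary linear φ: only antisymmetry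
and Jacobi in g are involved. -/
theorem lie_map_boundary {M : Type w} [LieRing M] [LieAlgebra K M] (φ : g →ₗ[K] M)
    (v x y z : g) :
    ⁅φ ⁅y, ⁅z, v⁆⁆, φ x⁆ + ⁅φ ⁅z, v⁆, φ ⁅y, x⁆⁆ + φ ⁅y, ⁅⁅z, v⁆, x⁆⁆
      + (⁅φ ⁅y, v⁆, φ ⁅z, x⁆⁆ + ⁅φ v, φ ⁅y, ⁅z, x⁆⁆⁆ + φ ⁅y, ⁅v, ⁅z, x⁆⁆⁆)
      - (⁅φ y, φ ⁅z, ⁅v, x⁆⁆⁆ + φ ⁅y, ⁅z, ⁅v, x⁆⁆⁆) =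
    (⁅φ ⁅⁅z, v⁆, x⁆, φ y⁆ + ⁅φ ⁅x, y⁆, φ ⁅z, v⁆⁆ + ⁅φ ⁅y, ⁅z, v⁆⁆, φ x⁆)
      + (⁅φ ⁅v, ⁅z, x⁆⁆, φ y⁆ + ⁅φ ⁅⁅z, x⁆, y⁆, φ v⁆ + ⁅φ ⁅y, v⁆, φ ⁅z, x⁆⁆) := by
  have h1 : ⁅φ ⁅z, v⁆, φ ⁅y, x⁆⁆ = ⁅φ ⁅x, y⁆, φ ⁅z, v⁆⁆ := by
    rw [← lie_skew, ← lie_skew x y, map_neg, neg_lie]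
  have h2 : ⁅φ v, φ ⁅y, ⁅z, x⁆⁆⁆ = ⁅φ ⁅⁅z, x⁆, y⁆, φ v⁆ := by
    rw [← lie_skew, ← lie_skew ⁅z, x⁆ y, map_neg, neg_lie]
  have h3 : ⁅φ y, φ ⁅z, ⁅v, x⁆⁆⁆ = -⁅φ ⁅⁅z, v⁆, x⁆, φ y⁆ - ⁅φ ⁅v, ⁅z, x⁆⁆, φ y⁆ := by
    rw [leibniz_lie z, map_add, lie_add, ← lie_skew, ← lie_skew (φ y) (φ ⁅v, ⁅z, x⁆⁆)]
    abel
  have h4 : φ ⁅y, ⁅z, ⁅v, x⁆⁆⁆ = φ ⁅y, ⁅⁅z, v⁆, x⁆⁆ + φ ⁅y, ⁅v, ⁅z, x⁆⁆⁆ := by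
    rw [leibniz_lie z, lie_add, map_add]
  rw [h1, h2, h3, h4]
  abel

theorem four_smul_inc_lie_psi_lie_lie_diff (v x y z : g) :
    (2 : K) • (2 : K) • ⁅inc K g y, ⁅psi K g z, ⁅diff K g v, diff K g x⁆⁆⁆ =
      jac ⁅z, v⁆ x y + jac v ⁅z, x⁆ y := by
  rw [← lie_smul, two_smul_psi_lie_lie_diff g, lie_sub, lie_add, smul_sub, smul_add,
    two_smul_inc_lie_lie_diff g, two_smul_inc_lie_lie_diff g,
    two_smul_inc_lie_diff]
  exact lie_map_boundary (diff K g) v x y z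

variable (K g) in
/-- The span of the elements `jac x y z`. -/
def jacSpan : Submodule K (Chi K g) := Submodule.span K {c | ∃ x y z : g, c = jac x y z}

theorem jac_mem_jacSpan (x y z : g) : (jac x y z : Chi K g) ∈ jacSpan K g :=
  Submodule.subset_span ⟨x, y, z, rfl⟩

/-- L(g) is spanned by odd and even elements, on which the double action gives boundaries;
conversely jac(x, y, z) = 4[y, [d x, z^ψ]]. -/
theorem R_eq_jacSpan (hK : (2 : K) ≠ 0) : R K g = jacSpan K g := by
  apply le_antisymm
  · refine Submodule.span_le.2 ?_
    rintro _ ⟨_, ⟨y, rfl⟩, m, hm, rfl⟩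
    change ⁅inc K g y, m⁆ ∈ jacSpan K g
    have h1 : bracketSpan (L K g).toSubmodule (copyR K g) ≤
        (jacSpan K g).comap (LieAlgebra.ad K (Chi K g) (inc K g y)) := by
      refine Submodule.span_le.2 ?_
      rintro _ ⟨l, hl, _, ⟨z, rfl⟩, rfl⟩
      change ⁅inc K g y, ⁅l, psi K g z⁆⁆ ∈ jacSpan K g
      have h2 : (diff K g).range ⊔ evenPart K g ≤ (jacSpan K g).comap
          (LieAlgebra.ad K (Chi K g) (inc K g y) ∘ₗ LieAlgebra.ad K (Chi K g) (psi K g z)) := by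
        refine sup_le ?_ (Submodule.span_le.2 ?_)
        · rintro _ ⟨x, rfl⟩
          change ⁅inc K g y, ⁅psi K g z, diff K g x⁆⁆ ∈ jacSpan K g
          refine mem_of_two_smul_mem hK (mem_of_two_smul_mem hK ?_)
          rw [four_smul_inc_lie_psi_lie_diff]
          exact Submodule.neg_mem _ (jac_mem_jacSpan _ _ _)
        · rintro _ ⟨v, x, rfl⟩
          change ⁅inc K g y, ⁅psi K g z, ⁅diff K g v, diff K g x⁆⁆⁆ ∈ jacSpan K g
          refine mem_of_two_smul_mem hK (mem_of_two_smul_mem hK ?_)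
          rw [four_smul_inc_lie_psi_lie_lie_diff]
          exact Submodule.add_mem _ (jac_mem_jacSpan _ _ _) (jac_mem_jacSpan _ _ _)
      have h3 : ⁅inc K g y, ⁅psi K g z, l⁆⁆ ∈ jacSpan K g := h2 (L_le g hK hl)
      rw [← lie_skew l, lie_neg]
      exact Submodule.neg_mem _ h3
    exact h1 hm
  · refine Submodule.span_le.2 ?_
    rintro _ ⟨x, y, z, rfl⟩
    rw [← neg_neg (jac x y z), ← four_smul_inc_lie_psi_lie_diff, ← smul_neg, ← smul_neg,
      ← lie_neg, lie_skew]
    refine Submodule.smul_mem _ _ (Submodule.smul_mem _ _ (Submodule.subset_span ?_))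
    exact ⟨_, ⟨y, rfl⟩, _, Submodule.subset_span ⟨_, diff_mem_L g x, _, ⟨z, rfl⟩, rfl⟩, rfl⟩

theorem lie_mem_R (hK : (2 : K) ≠ 0) (c : Chi K g) {n : Chi K g} (hn : n ∈ R K g) :
    ⁅c, n⁆ ∈ R K g := by
  rw [R_eq_jacSpan hK] at hn ⊢
  have key (c : Chi K g) (h : ∀ x y z : g, (2 : K) • ⁅c, (jac x y z : Chi K g)⁆ ∈ jacSpan K g)
      (n : Chi K g) (hn : n ∈ jacSpan K g) : ⁅c, n⁆ ∈ jacSpan K g := by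
    have : jacSpan K g ≤ (jacSpan K g).comap (LieAlgebra.ad K (Chi K g) c) := by
      refine Submodule.span_le.2 ?_
      rintro _ ⟨x, y, z, rfl⟩
      exact mem_of_two_smul_mem (N := jacSpan K g) (m := ⁅c, jac x y z⁆) hK (h x y z)
    exact this hn
  refine lie_mem_of_inc_psi K g _ (fun u => key _ ?_) (fun u => key _ ?_) c hn
  · intro x y z
    rw [two_smul_inc_lie_jac]
    exact Submodule.add_mem _ (Submodule.add_mem _ (jac_mem_jacSpan _ _ _)
      (jac_mem_jacSpan _ _ _)) (jac_mem_jacSpan _ _ _)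
  · intro x y z
    rw [two_smul_psi_lie_jac]
    exact Submodule.add_mem _ (Submodule.add_mem _ (jac_mem_jacSpan _ _ _)
      (jac_mem_jacSpan _ _ _)) (jac_mem_jacSpan _ _ _)

/-- In [y, [l, z^ψ]] each coordinate of ρ is killed by one factor: the third by y, the second by l,
the first by z^ψ. -/
theorem R_le_W : R K g ≤ (W K g).toSubmodule := by
  refine Submodule.span_le.2 ?_
  rintro _ ⟨_, ⟨y, rfl⟩, m, hm, rfl⟩
  have h1 : bracketSpan (L K g).toSubmodule (copyR K g) ≤
      (W K g).toSubmodule.comap (LieAlgebra.ad K (Chi K g) (inc K g y)) := by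
    refine Submodule.span_le.2 ?_
    rintro _ ⟨l, hl, _, ⟨z, rfl⟩, rfl⟩
    change rho K g ⁅inc K g y, ⁅l, psi K g z⁆⁆ = 0
    have h2 : (rho K g l).2.1 = 0 := by
      rw [← alpha_eq_rho]
      exact hl
    rw [LieHom.map_lie, LieHom.map_lie, rho_inc, rho_psi]
    simp [Prod.ext_iff, h2]
  exact h1 hm

end Structure

/-! ### The explicit elements as boundaries. -/

section Elements

variable {K : Type u} {g : Type v} {X : Type w} [Field K] [LieRing g] [LieAlgebra K g]

theorem lie_diff_iterate_two_mul (y v : g) (m : ℕ) :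
    (fun z => ⁅diff K g y, z⁆)^[2 * m] (diff K g v) = diff K g ((fun z => ⁅y, z⁆)^[2 * m] v) := by
  induction m generalizing v with
  | zero => rfl
  | succ m ih =>
    rw [Nat.mul_succ, Function.iterate_add_apply, Function.iterate_add_apply]
    change (fun z => ⁅diff K g y, z⁆)^[2 * m] ⁅diff K g y, ⁅diff K g y, diff K g v⁆⁆ = _
    rw [diff_lie_lie_diff, ih]
    rfl

/-- The triple identity moves pairs of letters a_j inside d, leaving [d[x_i, x_j], d[x_j, v]] - [[d
x_i, d x_j], [d x_j, d v]]; expanding the last bracket by Leibniz produces the other two boundary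
terms. -/
theorem f_eq_neg_jac (x : X → g) (i j k : X) (m : ℕ) :
    f K x i j k (2 * m + 2) =
      -jac ⁅x i, x j⁆ (x j) ((fun z => ⁅x j, z⁆)^[2 * m] ⁅x j, x k⁆) := by
  have h1 : (fun z => ⁅a K x j, z⁆)^[2 * m + 2] (a K x k) =
      diff K g ⁅x j, (fun z => ⁅x j, z⁆)^[2 * m] ⁅x j, x k⁆⁆ := by
    change (fun z => ⁅diff K g (x j), z⁆)^[2 * (m + 1)] (diff K g (x k)) = _
    rw [lie_diff_iterate_two_mul, ← Function.iterate_succ_apply' (fun z => ⁅x j, z⁆),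
      ← Function.iterate_succ_apply (fun z => ⁅x j, z⁆)]
    rfl
  have h2 : (fun z => ⁅a K x j, z⁆)^[2 * m + 2 - 1] (b K x j k) =
      ⁅diff K g (x j), diff K g ((fun z => ⁅x j, z⁆)^[2 * m] ⁅x j, x k⁆)⁆ := by
    change (fun z => ⁅diff K g (x j), z⁆)^[2 * m + 1] (diff K g ⁅x j, x k⁆) = _
    rw [Function.iterate_succ_apply', lie_diff_iterate_two_mul]
  rw [f, h1, h2]
  generalize (fun z => ⁅x j, z⁆)^[2 * m] ⁅x j, x k⁆ = v
  change ⁅diff K g ⁅x i, x j⁆, diff K g ⁅x j, v⁆⁆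
    - ⁅⁅diff K g (x i), diff K g (x j)⁆, ⁅diff K g (x j), diff K g v⁆⁆ = _
  rw [leibniz_lie _ (diff K g (x j)), lie_lie_diff, lie_lie_diff, jac,
    ← lie_skew (diff K g ⁅x i, x j⁆), ← lie_skew (diff K g (x j)), ← lie_skew v, map_neg, neg_lie]
  abel

theorem f_mem_R (hK : (2 : K) ≠ 0) (x : X → g) (i j k : X) {n : ℕ} (hn : Even n) (h0 : 0 < n) :
    f K x i j k n ∈ R K g := by
  obtain ⟨m, rfl⟩ := hn.two_dvd
  obtain ⟨m, rfl⟩ := Nat.exists_eq_succ_of_ne_zero (n := m) (by lia)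
  rw [R_eq_jacSpan hK]
  change f K x i j k (2 * m + 2) ∈ _
  rw [f_eq_neg_jac]
  exact Submodule.neg_mem _ (jac_mem_jacSpan _ _ _)

end Elements

/-! ### A matrix representation detecting the elements. -/

section Detection

open Polynomial

section Matrices

variable {A : Type u} [CommRing A]

/-- The matrices in which one copy of `g` is represented. -/
def topRow (d p q : A) : Matrix (Fin 4) (Fin 4) A :=
  !![d, p, q, 0; 0, 0, 0, 0; 0, 0, 0, 0; 0, 0, 0, 0]

/-- The matrices in which the other copy of `g` is represented. -/
def lastColumn (d p q : A) : Matrix (Fin 4) (Fin 4) A :=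
  !![0, 0, 0, 0; 0, 0, 0, q; 0, 0, 0, -p; 0, 0, 0, -d]

theorem topRow_add (d p q d' p' q' : A) :
    topRow d p q + topRow d' p' q' = topRow (d + d') (p + p') (q + q') := by
  simp [topRow]

theorem lastColumn_add (d p q d' p' q' : A) :
    lastColumn d p q + lastColumn d' p' q' = lastColumn (d + d') (p + p') (q + q') := by
  simp [lastColumn, add_comm]

theorem smul_topRow {R : Type v} [CommRing R] [Algebra R A] (c : R) (d p q : A) :
    c • topRow d p q = topRow (c • d) (c • p) (c • q) := by
  simp [topRow]

theorem smul_lastColumn {R : Type v} [CommRing R] [Algebra R A] (c : R) (d p q : A) :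
    c • lastColumn d p q = lastColumn (c • d) (c • p) (c • q) := by
  simp [lastColumn]

theorem neg_lastColumn (d p q : A) : -lastColumn d p q = lastColumn (-d) (-p) (-q) := by
  simp [lastColumn]

theorem topRow_zero : topRow (0 : A) 0 0 = 0 := by
  ext i j
  fin_cases i <;> fin_cases j <;> simp [topRow]

theorem lastColumn_zero : lastColumn (0 : A) 0 0 = 0 := by
  ext i j
  fin_cases i <;> fin_cases j <;> simp [lastColumn]

theorem topRow_lie_topRow (d p q d' p' q' : A) :
    ⁅topRow d p q, topRow d' p' q'⁆ = topRow 0 (d * p' - d' * p) (d * q' - d' * q) := by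
  ext i j
  fin_cases i <;> fin_cases j <;> simp [topRow, Ring.lie_def, mul_comm]

/-- The parameters transform exactly as for `topRow`, so x and x^ψ keep equal parameters under
brackets. -/
theorem lastColumn_lie_lastColumn (d p q d' p' q' : A) :
    ⁅lastColumn d p q, lastColumn d' p' q'⁆ =
      lastColumn 0 (d * p' - d' * p) (d * q' - d' * q) := by
  ext i j
  fin_cases i <;> fin_cases j <;> 
    (simp [lastColumn, Ring.lie_def, mul_comm]; try abel)

/-- The corner determinant vanishes for equal parameters, which is weak commutativity. -/
theorem topRow_lie_lastColumn (d p q d' p' q' : A) :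
    ⁅topRow d p q, lastColumn d' p' q'⁆ = Matrix.single 0 3 (p * q' - q * p') := by
  ext i j
  fin_cases i <;> fin_cases j <;>
    simp [topRow, lastColumn, Ring.lie_def, Matrix.single, sub_eq_add_neg]

end Matrices

attribute [local instance] LieRing.ofAssociativeRing

theorem lastColumn_lie_topRow {A : Type u} [CommRing A] (d p q d' p' q' : A) :
    ⁅lastColumn d p q, topRow d' p' q'⁆ = Matrix.single 0 3 (q' * p - p' * q) := by
  rw [← lie_skew, topRow_lie_lastColumn, Matrix.single_neg, neg_sub]

theorem four_ne_zero_of_two_ne_zero {K : Type u} [Field K] (hK : (2 : K) ≠ 0) : (4 : K) ≠ 0 := by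
  have : (4 : K) = 2 * 2 := by norm_num
  rw [this]
  exact mul_ne_zero hK hK

section FreeBasis

variable {K : Type u} {g : Type v} {X : Type w} [Field K] [LieRing g] [LieAlgebra K g] {x : X → g}

theorem IsFreeBasis.exists_lift (hx : IsFreeBasis K x) {M : Type*} [LieRing M] [LieAlgebra K M]
    (m : X → M) : ∃ F : g →ₗ⁅K⁆ M, ∀ i, F (x i) = m i := by
  let e : FreeLieAlgebra K X ≃ₗ⁅K⁆ g := LieEquiv.ofBijective (FreeLieAlgebra.lift K x) hx
  refine ⟨(FreeLieAlgebra.lift K m).comp (e.symm : g →ₗ⁅K⁆ FreeLieAlgebra K X), fun i => ?_⟩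
  have h : e (FreeLieAlgebra.of K i) = x i := FreeLieAlgebra.lift_of_apply x i
  have h' : e.symm (x i) = FreeLieAlgebra.of K i := by rw [← h, LieEquiv.symm_apply_apply]
  change FreeLieAlgebra.lift K m (e.symm (x i)) = m i
  rw [h', FreeLieAlgebra.lift_of_apply]

theorem IsFreeBasis.mem_of_mem (hx : IsFreeBasis K x) (S : LieSubalgebra K g)
    (hS : ∀ i, x i ∈ S) (y : g) : y ∈ S := by
  have h : S.incl.comp (FreeLieAlgebra.lift K fun i => (⟨x i, hS i⟩ : S)) =
      FreeLieAlgebra.lift K x := by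
    ext i
    simp
  obtain ⟨y, rfl⟩ := hx.2 y
  rw [← h]
  exact (FreeLieAlgebra.lift K (fun i => (⟨x i, hS i⟩ : S)) y).2

theorem IsFreeBasis.isFinitelyPresentable (hx : IsFreeBasis K x) [Finite X] :
    IsFinitelyPresentable K g := by
  obtain ⟨n, ⟨e⟩⟩ := Finite.exists_equiv_fin X
  -- A free Lie algebra of finite rank needs no relators.
  refine ⟨n, ∅, Set.finite_empty, ?_⟩
  let F := FreeLieAlgebra.lift K (x ∘ e.symm)
  let G := FreeLieAlgebra.lift K (FreeLieAlgebra.of K ∘ e : X → FreeLieAlgebra K (Fin n))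
  let G' := FreeLieAlgebra.lift K (FreeLieAlgebra.of K ∘ e.symm : Fin n → FreeLieAlgebra K X)
  have h1 : G.comp G' = LieHom.id := by ext; simp [G, G']
  have h2 : G'.comp G = LieHom.id := by ext; simp [G, G']
  have h3 : F = (FreeLieAlgebra.lift K x).comp G' := by ext; simp [F, G']
  have hG' : Function.Bijective G' :=
    Function.bijective_iff_has_inverse.2 ⟨G, fun y => LieHom.congr_fun h1 y,
      fun y => LieHom.congr_fun h2 y⟩
  have hF : Function.Bijective F := by
    rw [h3]
    exact hx.comp hG'
  have hker : F.ker = LieSubmodule.lieSpan K (FreeLieAlgebra K (Fin n)) ∅ := by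
    rw [LieSubmodule.span_empty, LieHom.ker_eq_bot]
    exact hF.1
  rw [← hker]
  have hr : Function.Bijective F.range.incl :=
    ⟨Subtype.val_injective, fun y => ⟨⟨y, hF.2 y⟩, rfl⟩⟩
  exact ⟨F.quotKerEquivRange.trans (LieEquiv.ofBijective F.range.incl hr)⟩

/-- A homomorphism from `χ(g)` to a matrix algebra prescribed on a free basis. -/
theorem IsFreeBasis.exists_chi_matrix (hx : IsFreeBasis K x) {A : Type*} [CommRing A] [Algebra K A]
    (d p q : X → A) : ∃ Φ : Chi K g →ₗ⁅K⁆ Matrix (Fin 4) (Fin 4) A, ∀ i,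
      Φ (inc K g (x i)) = topRow (d i) (p i) (q i) ∧
      Φ (psi K g (x i)) = lastColumn (d i) (p i) (q i) := by
  obtain ⟨F, hF⟩ := hx.exists_lift fun i => topRow (d i) (p i) (q i)
  obtain ⟨G, hG⟩ := hx.exists_lift fun i => lastColumn (d i) (p i) (q i)
  -- The y for which F y and G y share their parameters.
  let S : LieSubalgebra K g :=
    { carrier := {y | ∃ d p q, F y = topRow d p q ∧ G y = lastColumn d p q}
      add_mem' := by
        rintro y z ⟨d, p, q, h1, h2⟩ ⟨d', p', q', h3, h4⟩
        exact ⟨_, _, _, by rw [map_add, h1, h3, topRow_add], by rw [map_add, h2, h4, lastColumn_add]⟩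
      zero_mem' := ⟨0, 0, 0, by rw [map_zero, topRow_zero], by rw [map_zero, lastColumn_zero]⟩
      smul_mem' := by
        rintro c y ⟨d, p, q, h1, h2⟩
        exact ⟨_, _, _, by rw [map_smul, h1, smul_topRow], by rw [map_smul, h2, smul_lastColumn]⟩
      lie_mem' := by
        rintro y z ⟨d, p, q, h1, h2⟩ ⟨d', p', q', h3, h4⟩
        exact ⟨_, _, _, by rw [LieHom.map_lie, h1, h3, topRow_lie_topRow],
          by rw [LieHom.map_lie, h2, h4, lastColumn_lie_lastColumn]⟩ }
  have hS (y : g) : y ∈ S := hx.mem_of_mem S (fun i => ⟨_, _, _, hF i, hG i⟩) y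
  have hFG (y : g) : ⁅F y, G y⁆ = 0 := by
    obtain ⟨d, p, q, h1, h2⟩ := hS y
    rw [h1, h2, topRow_lie_lastColumn, mul_comm, sub_self, Matrix.single_zero]
  exact ⟨chiLift F G hFG, fun i => ⟨by rw [chiLift_inc, hF], by rw [chiLift_psi, hG]⟩⟩

/-- The image of a_j acts by t on the top row and by -t on the last column; this sign is why the
parity of n matters. -/
theorem iterate_lie_add {A : Type*} [CommRing A] (t q s : A) (n : ℕ) :
    (fun z => ⁅topRow t 0 0 - lastColumn t 0 0, z⁆)^[n] (topRow 0 0 q + lastColumn 0 0 s) =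
      topRow 0 0 (t ^ n * q) + lastColumn 0 0 ((-t) ^ n * s) := by
  induction n with
  | zero => simp
  | succ n ih =>
    rw [Function.iterate_succ_apply', ih]
    simp only [sub_lie, lie_add, topRow_lie_topRow, lastColumn_lie_lastColumn,
      topRow_lie_lastColumn, lastColumn_lie_topRow]
    simp [pow_succ', mul_assoc, sub_eq_add_neg, neg_lastColumn]

theorem lie_topRow_add_lastColumn {A : Type*} [CommRing A] (r s r' s' : A) :
    ⁅topRow 0 r 0 + lastColumn 0 s 0, topRow 0 0 r' + lastColumn 0 0 s'⁆ =
      Matrix.single 0 3 (r * s' + r' * s) := by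
  simp only [add_lie, lie_add, topRow_lie_topRow, lastColumn_lie_lastColumn,
    topRow_lie_lastColumn, lastColumn_lie_topRow]
  simp [topRow_zero, lastColumn_zero, Matrix.single_add, add_comm]

/-- A linear functional with values in `K[X]` that detects the elements `f x i j k n`, `n` even. -/
theorem IsFreeBasis.exists_detect (hx : IsFreeBasis K x) {i j k : X} (hij : i ≠ j) (hik : i ≠ k)
    (hjk : j ≠ k) : ∃ φ : Chi K g →ₗ[K] K[X], ∀ n, Even n → 0 < n →
      φ (f K x i j k n) = (4 : K) • (Polynomial.X : K[X]) ^ (n + 1) := by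
  classical
  -- One parameter for each of the three letters: x_j scales, while x_i and x_k supply the two
  -- entries of the determinant.
  obtain ⟨Φ, hΦ⟩ := hx.exists_chi_matrix (A := K[X]) (fun l => if l = j then Polynomial.X else 0)
    (fun l => if l = i then 1 else 0) (fun l => if l = k then 1 else 0)
  refine ⟨Matrix.entryLinearMap K K[X] 0 3 ∘ₗ (Φ : Chi K g →ₗ[K] Matrix (Fin 4) (Fin 4) K[X]), ?_⟩
  intro n hn h0
  change Φ (f K x i j k n) 0 3 = _
  have hi : Φ (a K x i) = topRow 0 1 0 + lastColumn 0 (-1) 0 := by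
    rw [a, map_sub, (hΦ i).1, (hΦ i).2, sub_eq_add_neg, neg_lastColumn]
    simp [hij, hik]
  have hj : Φ (a K x j) = topRow Polynomial.X 0 0 - lastColumn Polynomial.X 0 0 := by
    rw [a, map_sub, (hΦ j).1, (hΦ j).2]
    simp [hij.symm, hjk]
  have hk : Φ (a K x k) = topRow 0 0 1 + lastColumn 0 0 (-1) := by
    rw [a, map_sub, (hΦ k).1, (hΦ k).2, sub_eq_add_neg, neg_lastColumn]
    simp [hik.symm, hjk.symm]
  have hbij : Φ (b K x i j) = topRow 0 (-Polynomial.X) 0 + lastColumn 0 Polynomial.X 0 := by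
    rw [b, map_sub, LieHom.map_lie, LieHom.map_lie, LieHom.map_lie, LieHom.map_lie, (hΦ i).1,
      (hΦ i).2, (hΦ j).1, (hΦ j).2, topRow_lie_topRow, lastColumn_lie_lastColumn, sub_eq_add_neg,
      neg_lastColumn]
    simp [hij, hik, hij.symm, hjk]
  have hbjk : Φ (b K x j k) = topRow 0 0 Polynomial.X + lastColumn 0 0 (-Polynomial.X) := by
    rw [b, map_sub, LieHom.map_lie, LieHom.map_lie, LieHom.map_lie, LieHom.map_lie, (hΦ k).1,
      (hΦ k).2, (hΦ j).1, (hΦ j).2, topRow_lie_topRow, lastColumn_lie_lastColumn, sub_eq_add_neg,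
      neg_lastColumn]
    simp [hik.symm, hjk.symm, hij.symm, hjk]
  have hit (n : ℕ) (c : Chi K g) : Φ ((fun z => ⁅a K x j, z⁆)^[n] c) =
      (fun z => ⁅topRow (Polynomial.X : K[X]) 0 0 - lastColumn Polynomial.X 0 0, z⁆)^[n] (Φ c) := by
    induction n with
    | zero => rfl
    | succ n ih =>
      rw [Function.iterate_succ_apply', Function.iterate_succ_apply', LieHom.map_lie, ih, hj]
  obtain ⟨m, rfl⟩ := Nat.exists_eq_add_of_lt h0
  rw [Nat.zero_add] at hn ⊢
  have hm : Odd m := by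
    rwa [Nat.even_add_one, Nat.not_even_iff_odd] at hn
  have haij : Φ ⁅a K x i, a K x j⁆ =
      topRow 0 (-Polynomial.X) 0 + lastColumn 0 (-Polynomial.X) 0 := by
    rw [LieHom.map_lie, hi, hj, sub_eq_add_neg, neg_lastColumn]
    simp [topRow_lie_topRow, lastColumn_lie_lastColumn, topRow_lie_lastColumn,
      lastColumn_lie_topRow]
  -- For n = m + 1 even, the first term contributes 2t^(n+1) and the second -2t^(n+1), so their
  -- difference is 4t^(n+1).
  rw [f, map_sub, LieHom.map_lie, LieHom.map_lie, haij, hit, hit, hk, hbij, hbjk,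
    iterate_lie_add, iterate_lie_add, Nat.add_sub_cancel, hn.neg_pow,
    hm.neg_pow, lie_topRow_add_lastColumn, lie_topRow_add_lastColumn, Matrix.sub_apply,
    Matrix.single_apply_same, Matrix.single_apply_same, Algebra.smul_def, map_ofNat]
  ring

theorem IsFreeBasis.not_finiteDimensional_R (hK : (2 : K) ≠ 0) (hx : IsFreeBasis K x)
    (hX : 3 ≤ Cardinal.mk X) : ¬ FiniteDimensional K (R K g) := by
  intro hfin
  have h4 := four_ne_zero_of_two_ne_zero hK
  obtain ⟨i⟩ : Nonempty X := by
    rw [← Cardinal.mk_ne_zero_iff]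
    rintro h
    simp [h] at hX
  obtain ⟨j, hij, -⟩ := Cardinal.exists_ne_ne_of_three_le hX i i
  obtain ⟨k, hik, hjk⟩ := Cardinal.exists_ne_ne_of_three_le hX i j
  obtain ⟨φ, hφ⟩ := hx.exists_detect hij.symm hik.symm hjk.symm
  let v (m : ℕ) : R K g :=
    ⟨f K x i j k (2 * m + 2), f_mem_R hK x i j k (by simp [parity_simps]) (by simp)⟩
  have hv : LinearIndependent K v := by
    refine LinearIndependent.of_comp ((4 : K)⁻¹ • φ ∘ₗ (R K g).subtype) ?_
    have h : ((4 : K)⁻¹ • φ ∘ₗ (R K g).subtype) ∘ v =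
        Polynomial.basisMonomials K ∘ fun m => 2 * m + 3 := by
      funext m
      change (4 : K)⁻¹ • φ (f K x i j k (2 * m + 2)) = _
      rw [hφ _ (by simp [parity_simps]) (by simp), smul_smul, inv_mul_cancel₀ h4, one_smul]
      simp [Polynomial.monomial_one_right_eq_X_pow]
    rw [h]
    exact (Polynomial.basisMonomials K).linearIndependent.comp _ fun m n hmn => by
      simpa using hmn
  have := hv.finite_of_isNoetherian
  exact not_finite ℕ

end FreeBasis

end Detection

end WeakComm

end

theorem theorem1p4 {K : Type*} [Field K] (hK : (2 : K) ≠ 0)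
    {g : Type*} [LieRing g] [LieAlgebra K g]
    {X : Type*} (x : X → g) (hx : WeakComm.IsFreeBasis K x)
    (hX : 3 ≤ Cardinal.mk X) :
    -- `R(g)` is an abelian ideal of `χ(g)`, contained in `W(g)`
    (∃ I : LieIdeal K (WeakComm.Chi K g),
      I.toSubmodule = WeakComm.R K g ∧ IsLieAbelian I ∧ I ≤ WeakComm.W K g) ∧
    -- `R(g)` is infinite-dimensional
    ¬ FiniteDimensional K (WeakComm.R K g) ∧
    -- the explicit elements lie in `R(g)` and `L(g)`, and are non-zero
    (∀ i j k : X, i ≠ j → i ≠ k → j ≠ k → ∀ n : ℕ, Even n → 0 < n →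
      WeakComm.f K x i j k n ∈ WeakComm.R K g ∧
      WeakComm.f K x i j k n ∈ WeakComm.L K g ∧
      WeakComm.f K x i j k n ≠ 0) ∧
    -- `W(g)` is infinite-dimensional, and `g` is finitely presentable when its rank is finite
    ¬ FiniteDimensional K (WeakComm.W K g) ∧
    (Finite X → WeakComm.IsFinitelyPresentable K g) := by
  have hR := hx.not_finiteDimensional_R hK hX
  refine ⟨?_, hR, ?_, ?_, fun _ => hx.isFinitelyPresentable⟩
  · let I : LieIdeal K (WeakComm.Chi K g) :=
      { WeakComm.R K g with lie_mem := fun {c _} hn => WeakComm.lie_mem_R hK c hn }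
    have hI : I ≤ WeakComm.W K g := fun c hc => WeakComm.R_le_W hc
    refine ⟨I, rfl, ⟨fun c d => Subtype.ext ?_⟩, hI⟩
    -- R ⊆ W ⊆ L and W centralizes L.
    exact WeakComm.lie_eq_zero_of_mem_W_of_mem_L g hK (hI c.2) (WeakComm.W_le_L g (hI d.2))
  · intro i j k hij hik hjk n hn h0
    have hf := WeakComm.f_mem_R hK x i j k hn h0
    refine ⟨hf, WeakComm.W_le_L g (WeakComm.R_le_W hf), fun h => ?_⟩
    obtain ⟨φ, hφ⟩ := hx.exists_detect hij hik hjk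
    have h4 := WeakComm.four_ne_zero_of_two_ne_zero hK
    have h1 := hφ n hn h0
    rw [h, map_zero] at h1
    exact smul_ne_zero h4 (pow_ne_zero _ Polynomial.X_ne_zero) h1.symm
  · intro hW
    exact hR (Submodule.finiteDimensional_of_le WeakComm.R_le_W)
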